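/- Let $\mathcal M\subset\mathbb R^n$ be a compact smooth embedded submanifold with the metric induced from $\mathbb R^n$, and let $F(z)=f(z)+h(c(z))$, where $f:\mathbb R^n\to\mathbb R$ and $c:\mathbb R^n\to\mathbb R^m$ are continuously differentiable with $\|\nabla f(z)-\nabla f(z')\|\le L_f\|z-z'\|$ and $\|\nabla c(z)-\nabla c(z')\|_2\le L_c\|z-z'\|$ for all $z,z'\in\mathbb R^n$ ($\nabla c(z)\in\mathbb R^{m\times n}$ is the Jacobian matrix), and $h:\mathbb R^m\to\mathbb R$ is convex with $|h(y)-h(y')|\le L_h\|y-y'\|$ for all $y,y'\in\mathbb R^m$; here $L_f,L_c,L_h>0$. Let $\mathrm{Retr}_z:\mathrm T_z\mathcal M\to\mathcal M$ ($z\in\mathcal M$) be retractions, i.e. smooth maps with $\mathrm{Retr}_z(0)=z$ and $\frac{d}{ds}\mathrm{Retr}_z(sv)|_{s=0}=v$, and suppose that there are $M_1,M_2>0$ such that $\|\mathrm{Retr}_z(\xi)-z\|\le M_1\|\xi\|$ and $\|\mathrm{Retr}_z(\xi)-(z+\xi)\|\le M_2\|\xi\|^2$ for all $z\in\mathcal M$,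 $\xi\in \mathrm T_z\mathcal M$. For $t>0$ put $$F(z;y)=f(y)+\nabla f(y)^\top(z-y)+h\big(c(y)+\nabla c(y)(z-y)\big),\qquad F_t(z;y)=F(z;y)+\tfrac1{2t}\|z-y\|^2,$$ and $S_t(y)=\operatorname{argmin}_{z\in y+\mathrm T_y\mathcal M}F_t(z;y)$. Fix a step size $t>0$ and one of two accuracy types: (LACC) with a parameter $\rho_l>0$, or (HACC) with a parameter $\rho_h\in(0,1/4)$. With $\rho=\rho_l$ under (LACC) and $\rho=\rho_h/(1-2\sqrt{\rho_h})$ under (HACC), let $c_0=1+1/(\sqrt{1+\rho}+\sqrt{\rho})^2$. The algorithm IManPL starts at some $z_0\in\mathcal M$ and, for $k=0,1,2,\dots$, 1. finds any $\tilde z_{k+1}\in z_k+\mathrm T_{z_k}\mathcal M$ such that $$F_t(\tilde z_{k+1};z_k)-F_t(S_t(z_k);z_k)\le\begin{cases}\rho_l\,\big(F(z_k)-F_t(\tilde z_{k+1};z_k)\big)&\text{under (LACC)},\\ \frac{\rho_h}{2t}\|\tilde z_{k+1}-z_k\|^2&\text{under (HACC)};\end{cases}$$ 2. sets $z_{k+1}=\mathrm{Retr}_{z_k}\big(\alpha_k(\tilde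 z_{k+1}-z_k)\big)$, where $\alpha_k$ is the largest element of $\{2^{-s}:s=0,1,2,\dots\}$ for which $$F(z_k)-F(z_{k+1})\ge\frac{c_0\alpha_k}{4t}\|z_k-\tilde z_{k+1}\|^2\quad\text{and}\quad \tfrac12\big(F(z_k)+F(z_k+\alpha_k(\tilde z_{k+1}-z_k);z_k)\big)-F(z_{k+1})\ge0 .$$ Then the line search in step 2 always terminates: for every $z_k\in\mathcal M$ and every $\tilde z_{k+1}$ as in step 1, such a largest $\alpha_k$ exists. Moreover, every sequence $(z_k)_{k\ge0}$ generated by the algorithm has accumulation points, and each accumulation point $z_\star$ belongs to $\mathcal M$ and is stationary for $\min_{z\in\mathcal M}F(z)$, i.e. $$0\in\mathrm{Proj}_{\mathrm T_{z_\star}\mathcal M}\big(\nabla f(z_\star)+\nabla c(z_\star)^\top\partial h(c(z_\star))\big),$$ where $\partial h$ is the convex subdifferential. -/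

import Mathlib

open scoped Manifold ContDiff InnerProductSpace Topology

noncomputable section

namespace IManPL

/-- The data `f`, `h`, `c` of the composite objective `F = f + h ∘ c` on `ℝⁿ`. -/
structure Problem (n m : ℕ) where
  f : EuclideanSpace ℝ (Fin n) → ℝ
  h : EuclideanSpace ℝ (Fin m) → ℝ
  c : EuclideanSpace ℝ (Fin n) → EuclideanSpace ℝ (Fin m)

namespace Problem

variable {n m : ℕ} (P : Problem n m)

/-- The objective `F(z) = f(z) + h(c(z))`. -/
def F (z : EuclideanSpace ℝ (Fin n)) : ℝ := P.f z + P.h (P.c z)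

/-- The partially linearized model
`F(z; y) = f(y) + ∇f(y)ᵀ(z - y) + h(c(y) + ∇c(y)(z - y))`. -/
def lin (z y : EuclideanSpace ℝ (Fin n)) : ℝ :=
  P.f y + ⟪gradient P.f y, z - y⟫_ℝ + P.h (P.c y + fderiv ℝ P.c y (z - y))

/-- The proximal linear model `F_t(z; y) = F(z; y) + ‖z - y‖² / (2t)`. -/
def prox (t : ℝ) (z y : EuclideanSpace ℝ (Fin n)) : ℝ :=
  P.lin z y + 1 / (2 * t) * ‖z - y‖ ^ 2

/-- Conditions on the objective: `f` and `c` are continuously differentiable with Lipschitz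
gradient and Lipschitz Jacobian (in the spectral norm), `h` is convex and Lipschitz. -/
structure Regular : Prop where
  f_smooth : ContDiff ℝ 1 P.f
  f_lip : ∃ Lf > 0, ∀ z z', ‖gradient P.f z - gradient P.f z'‖ ≤ Lf * ‖z - z'‖
  h_convex : ConvexOn ℝ Set.univ P.h
  h_lip : ∃ Lh > 0, ∀ y y', |P.h y - P.h y'| ≤ Lh * ‖y - y'‖
  c_smooth : ContDiff ℝ 1 P.c
  c_lip : ∃ Lc > 0, ∀ z z', ‖fderiv ℝ P.c z - fderiv ℝ P.c z'‖ ≤ Lc * ‖z - z'‖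

end Problem

/-- The convex subdifferential of `h` at `y`. -/
def subdifferential {m : ℕ} (h : EuclideanSpace ℝ (Fin m) → ℝ) (y : EuclideanSpace ℝ (Fin m)) :
    Set (EuclideanSpace ℝ (Fin m)) :=
  {v | ∀ y', h y + ⟪v, y' - y⟫_ℝ ≤ h y'}

section Manifold

variable {n m : ℕ} (d : ℕ) {M : Set (EuclideanSpace ℝ (Fin n))}
  [ChartedSpace (EuclideanSpace ℝ (Fin d)) M]

/-- The tangent space `T_z M`, as a linear subspace of the ambient space `ℝⁿ`: the range of the
differential of the inclusion `M → ℝⁿ` at `z`. -/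
def tangent (z : M) : Submodule ℝ (EuclideanSpace ℝ (Fin n)) :=
  LinearMap.range (mfderiv (𝓡 d) 𝓘(ℝ, EuclideanSpace ℝ (Fin n))
    (Subtype.val : M → EuclideanSpace ℝ (Fin n)) z).toLinearMap

/-- `Retr` is a family of retractions `Retr_z : T_z M → M`. -/
structure IsRetraction (Retr : (z : M) → tangent d z → M) : Prop where
  smooth : ∀ z, ContMDiff 𝓘(ℝ, tangent d z) (𝓡 d) ∞ (Retr z)
  map_zero : ∀ z, Retr z 0 = z
  deriv_zero : ∀ (z : M) (v : tangent d z),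
    HasDerivAt (fun s : ℝ => (Retr z (s • v) : EuclideanSpace ℝ (Fin n)))
      (v : EuclideanSpace ℝ (Fin n)) 0

/-- The uniform first and second order bounds
`‖Retr_z(ξ) - z‖ ≤ M₁ ‖ξ‖` and `‖Retr_z(ξ) - (z + ξ)‖ ≤ M₂ ‖ξ‖²`. -/
def RetractionBounds (Retr : (z : M) → tangent d z → M) : Prop :=
  ∃ M₁ > 0, ∃ M₂ > 0, ∀ (z : M) (ξ : tangent d z),
    ‖(Retr z ξ : EuclideanSpace ℝ (Fin n)) - z‖ ≤ M₁ * ‖ξ‖ ∧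
    ‖(Retr z ξ : EuclideanSpace ℝ (Fin n)) - (z + ξ)‖ ≤ M₂ * ‖ξ‖ ^ 2

/-- First-order stationarity: `0 ∈ Proj_{T_z M} (∇f(z) + ∇c(z)ᵀ ∂h(c(z)))`. -/
def IsStationary (P : Problem n m) (z : M) : Prop :=
  (0 : EuclideanSpace ℝ (Fin n)) ∈
    (tangent d z).starProjection ''
      ((fun v => gradient P.f z + (fderiv ℝ P.c z).adjoint v) ''
        subdifferential P.h (P.c z))

/-- `s = S_t(z)`: `s` is the (unique) minimizer of `F_t(·; z)` over `z + T_z M`. -/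
def IsExactSolution (P : Problem n m) (t : ℝ) (z : M) (s : EuclideanSpace ℝ (Fin n)) : Prop :=
  s - z ∈ tangent d z ∧
    ∀ y : EuclideanSpace ℝ (Fin n), y - z ∈ tangent d z → P.prox t s z ≤ P.prox t y z

/-- The inexact type: low accuracy with parameter `ρ_l`, or high accuracy with parameter `ρ_h`. -/
inductive InexactType where
  | lacc (ρl : ℝ)
  | hacc (ρh : ℝ)

namespace InexactType

/-- The admissible range of the parameter. -/
def Valid : InexactType → Prop
  | lacc ρl => 0 < ρl
  | hacc ρh => 0 < ρh ∧ ρh < 1 / 4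

/-- The right-hand side of the termination condition for the subproblem at `z`. -/
def tolerance (P : Problem n m) (t : ℝ) (z ztil : EuclideanSpace ℝ (Fin n)) : InexactType → ℝ
  | lacc ρl => ρl * (P.F z - P.prox t ztil z)
  | hacc ρh => ρh / (2 * t) * ‖ztil - z‖ ^ 2

/-- The line search constant `c₀`. -/
def c₀ : InexactType → ℝ
  | lacc ρl => 1 + 1 / (√(1 + ρl) + √ρl) ^ 2
  | hacc ρh =>
      1 + 1 / (√(1 + ρh / (1 - 2 * √ρh)) + √(ρh / (1 - 2 * √ρh))) ^ 2

end InexactType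

/-- `ztil ∈ z + T_z M` is an inexact solution of the subproblem at `z`:
`F_t(ztil; z) - F_t(S_t(z); z)` is at most the tolerance. -/
def IsInexactSolution (P : Problem n m) (IT : InexactType) (t : ℝ) (z : M)
    (ztil : EuclideanSpace ℝ (Fin n)) : Prop :=
  ztil - z ∈ tangent d z ∧
    ∀ s, IsExactSolution d P t z s →
      P.prox t ztil z - P.prox t s z ≤ IT.tolerance P t z ztil

/-- The two conditions tested by the backtracking line search at `z`, along the tangent direction
`ξ = ztil - z`, for the shrinkage factor `α`. -/
def LineSearchTest (P : Problem n m) (Retr : (z : M) → tangent d z → M) (IT : InexactType)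
    (t : ℝ) (z : M) (ξ : tangent d z) (α : ℝ) : Prop :=
  IT.c₀ * α / (4 * t) * ‖ξ‖ ^ 2 ≤ P.F z - P.F (Retr z (α • ξ)) ∧
  0 ≤ 1 / 2 * (P.F z + P.lin (z + α • (ξ : EuclideanSpace ℝ (Fin n))) z) - P.F (Retr z (α • ξ))

/-- `α` is the largest element of `{2^{-s} : s ∈ ℕ}` that passes the line search test. -/
def IsLineSearchStep (P : Problem n m) (Retr : (z : M) → tangent d z → M) (IT : InexactType)
    (t : ℝ) (z : M) (ξ : tangent d z) (α : ℝ) : Prop :=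
  IsGreatest {a : ℝ | (∃ s : ℕ, a = (1 / 2) ^ s) ∧ LineSearchTest d P Retr IT t z ξ a} α

/-- One iteration of the algorithm with step size `t` can lead from `z` to `z'`: for some inexact
solution `ztil` of the subproblem at `z`, the line search returns `α` and
`z' = Retr_z(α (ztil - z))`. -/
def IsStep (P : Problem n m) (Retr : (z : M) → tangent d z → M) (IT : InexactType)
    (t : ℝ) (z z' : M) : Prop :=
  ∃ (ztil : EuclideanSpace ℝ (Fin n)) (hz : ztil - z ∈ tangent d z) (α : ℝ),
    IsInexactSolution d P IT t z ztil ∧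
    IsLineSearchStep d P Retr IT t z ⟨ztil - z, hz⟩ α ∧
    z' = Retr z (α • ⟨ztil - z, hz⟩)

/-- `z` is a sequence of iterates of the inexact manifold proximal linear algorithm with step
sizes `t k`. -/
def IsIterates (P : Problem n m) (Retr : (z : M) → tangent d z → M) (IT : InexactType)
    (t : ℕ → ℝ) (z : ℕ → M) : Prop :=
  ∀ k, IsStep d P Retr IT (t k) (z k) (z (k + 1))

end Manifold

end IManPL

end

namespace IManPL

open Filter Set

/-! The proximal model is strongly convex, so suboptimality controls the squared distance to the
exact solution `s`. Either accuracy type bounds the suboptimality of `y` by `ρ` times the model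
decrease `A = F(z) - F_t(y; z)`. Quadratic growth at `y` and at `z`, with the triangle inequality,
gives `‖y - z‖² ≤ (√(1+ρ) + √ρ)² · 2tA`, which is where `c₀` comes from
(`IsInexactSolution.decrease`).

Along the retraction `F` exceeds the linearized model by at most `C‖ξ‖²`, uniformly on the compact
`M` (`exists_F_retraction_le`). One power of `1/2` therefore passes the test at every iterate, so
accepted steps are bounded below. As `F(z_k)` decreases and is bounded below, `y_k - z_k → 0`.

At an accumulation point, the approximate optimality of `y_k` passes to the limit, because tangent
vectors there are limits of tangent vectors at the iterates. The point thus minimizes its own model,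
and Hahn–Banach separation turns this into stationarity. -/

/-- First order Taylor estimate for a map with Lipschitz derivative. -/
lemma norm_sub_sub_fderiv_le {E F : Type*} [NormedAddCommGroup E] [NormedSpace ℝ E]
    [NormedAddCommGroup F] [NormedSpace ℝ F] {g : E → F} {L : ℝ} (hL : 0 ≤ L)
    (hg : Differentiable ℝ g) (hlip : ∀ x y, ‖fderiv ℝ g x - fderiv ℝ g y‖ ≤ L * ‖x - y‖)
    (x y : E) : ‖g x - g y - fderiv ℝ g y (x - y)‖ ≤ L * ‖x - y‖ ^ 2 := by
  have h := Convex.norm_image_sub_le_of_norm_fderiv_le' (𝕜 := ℝ) (f := g)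
    (C := L * ‖x - y‖) (s := Metric.closedBall y ‖x - y‖) (x := y) (y := x)
    (φ := fderiv ℝ g y) (fun z _ => hg z) (fun z hz => ?_) (convex_closedBall _ _)
    (by simp) (by simp [dist_eq_norm])
  · rwa [sq, ← mul_assoc]
  · refine (hlip z y).trans (mul_le_mul_of_nonneg_left ?_ hL)
    simpa [dist_eq_norm] using hz

/-! ### Continuity and convexity of the linearized and proximal models. -/

namespace Problem

variable {n m : ℕ} {P : Problem n m}

lemma Regular.differentiable_f (hP : P.Regular) : Differentiable ℝ P.f :=
  hP.f_smooth.differentiable one_ne_zero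

lemma Regular.differentiable_c (hP : P.Regular) : Differentiable ℝ P.c :=
  hP.c_smooth.differentiable one_ne_zero

lemma Regular.continuous_gradient (hP : P.Regular) : Continuous (gradient P.f) :=
  (InnerProductSpace.toDual ℝ _).symm.continuous.comp (hP.f_smooth.continuous_fderiv one_ne_zero)

lemma Regular.continuous_h (hP : P.Regular) : Continuous P.h := by
  obtain ⟨L, hL, h⟩ := hP.h_lip
  refine (LipschitzWith.of_dist_le_mul (K := ⟨L, hL.le⟩) fun x y => ?_).continuous
  rw [dist_eq_norm, dist_eq_norm]
  exact h x y

lemma Regular.continuous_F (hP : P.Regular) : Continuous P.F :=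
  hP.f_smooth.continuous.add (hP.continuous_h.comp hP.c_smooth.continuous)

lemma Regular.continuous_lin (hP : P.Regular) :
    Continuous fun p : EuclideanSpace ℝ (Fin n) × EuclideanSpace ℝ (Fin n) => P.lin p.1 p.2 := by
  have h1 := hP.continuous_gradient
  have h2 := hP.continuous_h
  have h3 := hP.c_smooth.continuous
  have h4 := hP.f_smooth.continuous
  have h5 := hP.c_smooth.continuous_fderiv one_ne_zero
  unfold lin
  refine ((h4.comp continuous_snd).add ((h1.comp continuous_snd).inner
    (continuous_fst.sub continuous_snd))).add (h2.comp ((h3.comp continuous_snd).add ?_))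
  exact (h5.comp continuous_snd).clm_apply (continuous_fst.sub continuous_snd)

lemma Regular.continuous_prox (hP : P.Regular) (t : ℝ) :
    Continuous fun p : EuclideanSpace ℝ (Fin n) × EuclideanSpace ℝ (Fin n) =>
      P.prox t p.1 p.2 := by
  unfold prox
  exact hP.continuous_lin.add (by fun_prop)

@[simp] lemma lin_self (y : EuclideanSpace ℝ (Fin n)) : P.lin y y = P.F y := by
  simp [lin, F]

@[simp] lemma prox_self (t : ℝ) (y : EuclideanSpace ℝ (Fin n)) : P.prox t y y = P.F y := by
  simp [prox]

lemma Regular.lin_combo_le (hP : P.Regular) {a : ℝ} (ha : 0 ≤ a) (ha' : a ≤ 1)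
    (u v y : EuclideanSpace ℝ (Fin n)) :
    P.lin ((1 - a) • u + a • v) y ≤ (1 - a) * P.lin u y + a * P.lin v y := by
  have h := hP.h_convex.2 (mem_univ (P.c y + fderiv ℝ P.c y (u - y)))
    (mem_univ (P.c y + fderiv ℝ P.c y (v - y))) (sub_nonneg.2 ha') ha (by ring)
  have e1 : (1 - a) • u + a • v - y = (1 - a) • (u - y) + a • (v - y) := by module
  have e2 : P.c y + fderiv ℝ P.c y ((1 - a) • u + a • v - y) =
      (1 - a) • (P.c y + fderiv ℝ P.c y (u - y)) + a • (P.c y + fderiv ℝ P.c y (v - y)) := by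
    rw [e1, map_add, map_smul, map_smul]; module
  have e3 : ⟪gradient P.f y, (1 - a) • u + a • v - y⟫_ℝ =
      (1 - a) * ⟪gradient P.f y, u - y⟫_ℝ + a * ⟪gradient P.f y, v - y⟫_ℝ := by
    rw [e1, inner_add_right, inner_smul_right, inner_smul_right]
  simp only [smul_eq_mul] at h
  unfold lin
  rw [e2, e3]
  linarith

/-- From the base point the model falls at most linearly, so the quadratic term makes the proximal
model coercive. -/
lemma Regular.F_sub_lin_le (hP : P.Regular) :
    ∃ L > 0, ∀ z y, P.F y - P.lin z y ≤
      (‖gradient P.f y‖ + L * ‖fderiv ℝ P.c y‖) * ‖z - y‖ := by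
  obtain ⟨L, hL, h⟩ := hP.h_lip
  refine ⟨L, hL, fun z y => ?_⟩
  have h1 := (abs_le.1 (h (P.c y + fderiv ℝ P.c y (z - y)) (P.c y))).1
  rw [add_sub_cancel_left] at h1
  have h2 := mul_le_mul_of_nonneg_left ((fderiv ℝ P.c y).le_opNorm (z - y)) hL.le
  have h3 := (abs_le.1 (abs_real_inner_le_norm (gradient P.f y) (z - y))).1
  unfold F lin
  nlinarith

/-- The proximal model satisfies the parallelogram-type strong convexity inequality. -/
lemma Regular.prox_combo_le (hP : P.Regular) (t : ℝ) {a : ℝ} (ha : 0 ≤ a) (ha' : a ≤ 1)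
    (u v y : EuclideanSpace ℝ (Fin n)) :
    P.prox t ((1 - a) • u + a • v) y ≤
      (1 - a) * P.prox t u y + a * P.prox t v y - a * (1 - a) * (1 / (2 * t) * ‖v - u‖ ^ 2) := by
  have h := hP.lin_combo_le ha ha' u v y
  have e1 : (1 - a) • u + a • v - y = (1 - a) • (u - y) + a • (v - y) := by module
  have e2 : v - u = (v - y) - (u - y) := by abel
  have e : ‖(1 - a) • u + a • v - y‖ ^ 2 =
      (1 - a) * ‖u - y‖ ^ 2 + a * ‖v - y‖ ^ 2 - a * (1 - a) * ‖v - u‖ ^ 2 := by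
    rw [e1, e2, norm_add_sq_real, norm_sub_sq_real (v - y), norm_smul, norm_smul, inner_smul_left,
      inner_smul_right, real_inner_comm, Real.norm_of_nonneg ha,
      Real.norm_of_nonneg (sub_nonneg.2 ha')]
    simp only [conj_trivial]
    ring
  unfold prox
  rw [e]
  linear_combination h

end Problem

/-! ### The tangent-space subproblem and its inexact solutions. -/

section Subproblem

variable {n m : ℕ} {d : ℕ} {M : Set (EuclideanSpace ℝ (Fin n))}
  [ChartedSpace (EuclideanSpace ℝ (Fin d)) M] {P : Problem n m}

/-- A continuous coercive function on a finite-dimensional space attains its minimum. Without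
existence, the accuracy condition in `IsInexactSolution` would be vacuous. -/
lemma exists_isExactSolution (hP : P.Regular) {t : ℝ} (ht : 0 < t) (z : M) :
    ∃ s, IsExactSolution d P t z s := by
  let q : tangent d z → ℝ := fun ξ => P.prox t ((z : EuclideanSpace ℝ (Fin n)) + ξ) z
  have hq : Continuous q :=
    (hP.continuous_prox t).comp
      ((continuous_const.add continuous_subtype_val).prodMk continuous_const)
  obtain ⟨L, hL, h⟩ := hP.F_sub_lin_le
  set K := ‖gradient P.f z‖ + L * ‖fderiv ℝ P.c z‖
  have hlow : ∀ ξ : tangent d z, P.F z + ‖ξ‖ * (1 / (2 * t) * ‖ξ‖ - K) ≤ q ξ := by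
    intro ξ
    have h1 := h ((z : EuclideanSpace ℝ (Fin n)) + ξ) z
    simp only [q, Problem.prox, add_sub_cancel_left, Submodule.coe_norm] at h1 ⊢
    nlinarith
  have hlim : Tendsto q (cocompact _) atTop := by
    refine tendsto_atTop_mono hlow (tendsto_atTop_add_const_left _ _ ?_)
    have hn := tendsto_norm_cocompact_atTop (E := tangent d z)
    exact hn.atTop_mul_atTop₀ (tendsto_atTop_add_const_right _ _
      (hn.const_mul_atTop (by positivity)))
  obtain ⟨ξ, hξ⟩ := hq.exists_forall_le hlim
  refine ⟨z + ξ, by simp, fun y hy => ?_⟩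
  simpa [q] using hξ ⟨y - z, hy⟩

/-- Quadratic growth of the proximal model at the exact solution of the subproblem. -/
lemma IsExactSolution.growth (hP : P.Regular) {t : ℝ} (ht : 0 < t) {z : M}
    {s : EuclideanSpace ℝ (Fin n)} (hs : IsExactSolution d P t z s)
    {y : EuclideanSpace ℝ (Fin n)} (hy : y - z ∈ tangent d z) :
    ‖y - s‖ ^ 2 ≤ 2 * t * (P.prox t y z - P.prox t s z) := by
  -- Minimality of `s` against `(1 - a)s + ay`, divided by `a`; then `a → 0`.
  have key : ∀ a : ℝ, 0 < a → a ≤ 1 →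
      (1 - a) * (1 / (2 * t) * ‖y - s‖ ^ 2) ≤ P.prox t y z - P.prox t s z := by
    intro a ha ha'
    have h1 := hs.2 ((1 - a) • s + a • y) (by
      have : (1 - a) • s + a • y - (z : EuclideanSpace ℝ (Fin n)) =
        (1 - a) • (s - z) + a • (y - z) := by module
      rw [this]
      exact add_mem (Submodule.smul_mem _ _ hs.1) (Submodule.smul_mem _ _ hy))
    have h2 := hP.prox_combo_le t ha.le ha' s y z
    refine le_of_mul_le_mul_left ?_ ha
    linarith
  have hK : 1 / (2 * t) * ‖y - s‖ ^ 2 ≤ P.prox t y z - P.prox t s z := by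
    have hlim : Tendsto (fun a : ℝ => (1 - a) * (1 / (2 * t) * ‖y - s‖ ^ 2)) (𝓝[>] 0)
        (𝓝 ((1 - 0) * (1 / (2 * t) * ‖y - s‖ ^ 2))) :=
      (Continuous.tendsto (by fun_prop) 0).mono_left nhdsWithin_le_nhds
    rw [sub_zero, one_mul] at hlim
    refine le_of_tendsto hlim ?_
    filter_upwards [Ioo_mem_nhdsGT (show (0 : ℝ) < 1 by norm_num)] with a ha
    exact key a ha.1 ha.2.le
  have : ‖y - s‖ ^ 2 = 2 * t * (1 / (2 * t) * ‖y - s‖ ^ 2) := by field_simp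
  rw [this]
  gcongr

namespace InexactType

/-- The common parameter `ρ` of the two accuracy types. -/
noncomputable def rho : InexactType → ℝ
  | lacc ρl => ρl
  | hacc ρh => ρh / (1 - 2 * √ρh)

lemma c₀_eq (IT : InexactType) : IT.c₀ = 1 + 1 / (√(1 + IT.rho) + √IT.rho) ^ 2 := by
  cases IT <;> rfl

lemma one_sub_two_sqrt_pos {ρ : ℝ} (h : ρ < 1 / 4) : 0 < 1 - 2 * √ρ := by
  have : √ρ < 1 / 2 := by
    rw [Real.sqrt_lt' (by norm_num)]; linarith
  linarith

lemma Valid.rho_pos {IT : InexactType} (h : IT.Valid) : 0 < IT.rho := by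
  cases IT with
  | lacc ρ => exact h
  | hacc ρ => exact div_pos h.1 (one_sub_two_sqrt_pos h.2)

lemma c₀_pos (IT : InexactType) : 0 < IT.c₀ := by
  rw [c₀_eq]; positivity

end InexactType

/-- Both accuracy types bound the suboptimality by `ρ` times the decrease of the model. -/
lemma IsInexactSolution.subopt_le (hP : P.Regular) {IT : InexactType} (hIT : IT.Valid) {t : ℝ}
    (ht : 0 < t) {z : M} {y s : EuclideanSpace ℝ (Fin n)} (hy : IsInexactSolution d P IT t z y)
    (hs : IsExactSolution d P t z s) :
    P.prox t y z - P.prox t s z ≤ IT.rho * (P.F z - P.prox t y z) := by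
  have h := hy.2 s hs
  cases IT with
  | lacc ρ => exact h
  | hacc ρ =>
    obtain ⟨h0, h4⟩ := hIT
    have hr := InexactType.one_sub_two_sqrt_pos h4
    have g1 := hs.growth hP ht hy.1
    have g2 := hs.growth hP ht (y := z) (by simp)
    rw [Problem.prox_self] at g2
    simp only [InexactType.tolerance, InexactType.rho] at h ⊢
    have hsq : √ρ ^ 2 = ρ := Real.sq_sqrt h0.le
    have hr0 := Real.sqrt_nonneg ρ
    set r := √ρ
    set x := ‖y - (z : EuclideanSpace ℝ (Fin n))‖
    have hx : 0 ≤ x := norm_nonneg _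
    have h' : 2 * t * (P.prox t y z - P.prox t s z) ≤ ρ * x ^ 2 := by
      calc _ ≤ 2 * t * (ρ / (2 * t) * x ^ 2) := by gcongr
        _ = _ := by field_simp
    have d1 : ‖y - s‖ ≤ r * x :=
      abs_le_of_sq_le_sq' (by rw [mul_pow, hsq]; exact g1.trans h') (by positivity) |>.2
    have d2 : (1 - r) * x ≤ ‖(z : EuclideanSpace ℝ (Fin n)) - s‖ := by
      have : x ≤ ‖y - s‖ + ‖(z : EuclideanSpace ℝ (Fin n)) - s‖ := by
        rw [norm_sub_rev (z : EuclideanSpace ℝ (Fin n)) s]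
        simpa [x] using norm_add_le (y - s) (s - z)
      linarith
    have d3 : ((1 - r) * x) ^ 2 ≤ 2 * t * (P.F z - P.prox t s z) :=
      (pow_le_pow_left₀ (by nlinarith) d2 2).trans g2
    -- Since `r² = ρ`, `(1 - r)² - ρ = 1 - 2r`: this is the denominator in `rho`, positive because
    -- `ρ < 1/4`.
    have d4 : (1 - 2 * r) * x ^ 2 ≤ 2 * t * (P.F z - P.prox t y z) := by
      nlinarith
    rw [div_mul_eq_mul_div, le_div_iff₀ hr]
    refine le_of_mul_le_mul_left ?_ (show 0 < 2 * t by positivity)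
    nlinarith [mul_le_mul_of_nonneg_left d4 h0.le, mul_le_mul_of_nonneg_left h' hr.le]

/-- The decrease of the linearized model at an inexact solution. -/
lemma IsInexactSolution.decrease (hP : P.Regular) {IT : InexactType} (hIT : IT.Valid) {t : ℝ}
    (ht : 0 < t) {z : M} {y : EuclideanSpace ℝ (Fin n)} (hy : IsInexactSolution d P IT t z y) :
    IT.c₀ / (2 * t) * ‖y - z‖ ^ 2 ≤ P.F z - P.lin y z := by
  obtain ⟨s, hs⟩ := exists_isExactSolution (d := d) hP ht z
  have h := hy.subopt_le hP hIT ht hs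
  have hρ := hIT.rho_pos
  have g1 := hs.growth hP ht hy.1
  have g2 := hs.growth hP ht (y := z) (by simp)
  rw [Problem.prox_self] at g2
  rw [InexactType.c₀_eq]
  set ρ := IT.rho
  set A := P.F z - P.prox t y z with hA
  -- If `A < 0`, the suboptimality, at most `ρA`, would be negative, against the minimality of `s`.
  have hA0 : 0 ≤ A := by
    have := hs.2 y hy.1
    by_contra! hneg
    nlinarith
  have e1 : ‖y - s‖ ≤ √ρ * √(2 * t * A) := by
    rw [← Real.sqrt_mul hρ.le]
    refine Real.le_sqrt_of_sq_le (g1.trans ?_)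
    nlinarith
  have e2 : ‖(z : EuclideanSpace ℝ (Fin n)) - s‖ ≤ √(1 + ρ) * √(2 * t * A) := by
    rw [← Real.sqrt_mul (by positivity)]
    refine Real.le_sqrt_of_sq_le (g2.trans ?_)
    nlinarith
  have e3 : ‖y - z‖ ≤ (√(1 + ρ) + √ρ) * √(2 * t * A) := by
    have : ‖y - z‖ ≤ ‖y - s‖ + ‖(z : EuclideanSpace ℝ (Fin n)) - s‖ := by
      rw [norm_sub_rev (z : EuclideanSpace ℝ (Fin n)) s]
      simpa using norm_add_le (y - s) (s - z)
    linarith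
  have e4 : ‖y - z‖ ^ 2 ≤ (√(1 + ρ) + √ρ) ^ 2 * (2 * t * A) := by
    refine (pow_le_pow_left₀ (norm_nonneg _) e3 2).trans_eq ?_
    rw [mul_pow, Real.sq_sqrt (by positivity)]
  have hS : 0 < (√(1 + ρ) + √ρ) ^ 2 := by positivity
  have e5 : 1 / (√(1 + ρ) + √ρ) ^ 2 / (2 * t) * ‖y - z‖ ^ 2 ≤ A := by
    rw [div_div, div_mul_eq_mul_div, one_mul, div_le_iff₀ (by positivity)]
    linarith
  -- The proximal term, absent from `lin`, supplies the summand `1` of `c₀`.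
  have e6 : P.F z - P.lin y z = A + 1 / (2 * t) * ‖y - z‖ ^ 2 := by
    rw [hA, Problem.prox]; ring
  rw [e6, add_div, add_mul]
  linarith

end Subproblem

/-! ### Limits of tangent vectors, and subgradients by separation. -/

/-- The tangent spaces of an embedded `C¹` submanifold are lower semicontinuous: every tangent
vector at `z` is a limit of tangent vectors at the nearby points. -/
lemma exists_tangent_vector_field {n d : ℕ} {M : Set (EuclideanSpace ℝ (Fin n))}
    [ChartedSpace (EuclideanSpace ℝ (Fin d)) M] [IsManifold (𝓡 d) 1 M]
    (hM : ContMDiff (𝓡 d) 𝓘(ℝ, EuclideanSpace ℝ (Fin n)) 1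
      (Subtype.val : M → EuclideanSpace ℝ (Fin n)))
    (z : M) {v : EuclideanSpace ℝ (Fin n)} (hv : v ∈ tangent d z) :
    ∃ V : M → EuclideanSpace ℝ (Fin n), (∀ y, V y ∈ tangent d y) ∧ Tendsto V (𝓝 z) (𝓝 v) := by
  obtain ⟨w, hw⟩ := hv
  let e := trivializationAt (EuclideanSpace ℝ (Fin d)) (TangentSpace (𝓡 d) : M → Type _) z
  have hz : z ∈ e.baseSet := FiberBundle.mem_baseSet_trivializationAt' z
  -- Extend `w` with constant coordinates in a trivialization. Values off `e.baseSet` do not matter: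
  -- their images under the differential are tangent anyway.
  let s : M → TangentBundle (𝓡 d) M := fun y => ⟨y, e.symm y (e ⟨z, w⟩).2⟩
  have hs : ContinuousAt s z := by
    have h1 : ContinuousOn (fun p : M × EuclideanSpace ℝ (Fin d) =>
        (⟨p.1, e.symm p.1 p.2⟩ : TangentBundle (𝓡 d) M)) (e.baseSet ×ˢ univ) :=
      e.continuousOn_symm
    have h2 : ContinuousAt (fun p : M × EuclideanSpace ℝ (Fin d) =>
        (⟨p.1, e.symm p.1 p.2⟩ : TangentBundle (𝓡 d) M)) (z, (e ⟨z, w⟩).2) :=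
      h1.continuousAt ((e.open_baseSet.prod isOpen_univ).mem_nhds ⟨hz, mem_univ _⟩)
    exact ContinuousAt.comp (f := fun y : M => (y, (e ⟨z, w⟩).2)) h2 (by fun_prop)
  have hsz : s z = ⟨z, w⟩ := by
    simp only [s]
    congr 1
    exact e.symm_apply_apply_mk hz w
  have hT := hM.continuous_tangentMap le_rfl
  have hsnd : Continuous fun p : TangentBundle 𝓘(ℝ, EuclideanSpace ℝ (Fin n))
      (EuclideanSpace ℝ (Fin n)) => (p.2 : EuclideanSpace ℝ (Fin n)) :=
    (contMDiff_snd_tangentBundle_modelSpace (n := 0) (EuclideanSpace ℝ (Fin n))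
      𝓘(ℝ, EuclideanSpace ℝ (Fin n))).continuous
  have hlim := (hsnd.comp hT).continuousAt.comp (f := s) hs
  refine ⟨fun y => mfderiv (𝓡 d) 𝓘(ℝ, EuclideanSpace ℝ (Fin n))
    (Subtype.val : M → EuclideanSpace ℝ (Fin n)) y (e.symm y (e ⟨z, w⟩).2),
    fun y => ⟨_, rfl⟩, ?_⟩
  have := hlim.tendsto
  simp only [Function.comp_apply, hsz] at this
  rw [← hw]
  exact this

/-- A convex function `h` that dominates a linear functional `-⟪g, ·⟫` along the image of a
subspace `T` has a subgradient which represents that functional on `T`. -/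
lemma exists_subgradient_of_forall_le {E : Type*} [NormedAddCommGroup E] [InnerProductSpace ℝ E]
    {m : ℕ} {h : EuclideanSpace ℝ (Fin m) → ℝ} (hconv : ConvexOn ℝ univ h) (hcont : Continuous h)
    (T : Submodule ℝ E) (J : E →L[ℝ] EuclideanSpace ℝ (Fin m)) (g : E)
    (y : EuclideanSpace ℝ (Fin m)) (hle : ∀ v ∈ T, h y ≤ ⟪g, v⟫_ℝ + h (y + J v)) :
    ∃ u ∈ subdifferential h y, ∀ v ∈ T, ⟪u, J v⟫_ℝ + ⟪g, v⟫_ℝ = 0 := by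
  -- Separate the strict epigraph of `h` from the affine set of points `(y + Jv, h y - ⟪g, v⟫)`, `v
  -- ∈ T`; `hle` says that they are disjoint.
  let S : Set (EuclideanSpace ℝ (Fin m) × ℝ) := {p | p.1 ∈ univ ∧ h p.1 < p.2}
  have hS : Convex ℝ S := hconv.convex_strict_epigraph
  have hSo : IsOpen S := by
    have : S = {p | h p.1 < p.2} := by ext p; simp [S]
    rw [this]
    exact isOpen_lt (hcont.comp continuous_fst) continuous_snd
  let A : E →ₗ[ℝ] EuclideanSpace ℝ (Fin m) × ℝ :=
    J.toLinearMap.prod (-(innerSL ℝ g).toLinearMap)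
  let W : Set (EuclideanSpace ℝ (Fin m) × ℝ) := (fun p => (y, h y) + p) '' (T.map A : Set _)
  have hW : Convex ℝ W := (T.map A).convex.translate (y, h y)
  have hdisj : Disjoint S W := by
    rw [Set.disjoint_left]
    rintro _ ⟨-, hp⟩ ⟨_, ⟨v, hv, rfl⟩, rfl⟩
    have := hle v hv
    simp [A] at hp
    linarith
  obtain ⟨Φ, b, hΦS, hΦW⟩ := geometric_hahn_banach_open hS hSo hW hdisj
  set p := (InnerProductSpace.toDual ℝ (EuclideanSpace ℝ (Fin m))).symm
    (Φ.comp (ContinuousLinearMap.inl ℝ _ ℝ)) with hp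
  set τ := Φ (0, 1) with hτ
  have hΦ : ∀ w r, Φ (w, r) = ⟪p, w⟫_ℝ + r * τ := by
    intro w r
    have : (w, r) = (w, (0 : ℝ)) + r • ((0 : EuclideanSpace ℝ (Fin m)), (1 : ℝ)) := by simp
    rw [this, map_add, map_smul, hp, InnerProductSpace.toDual_symm_apply]
    simp [hτ]
  have hb : b ≤ Φ (y, h y) := by
    have := hΦW ((y, h y) + 0) ⟨0, ⟨0, T.zero_mem, by simp⟩, rfl⟩
    simpa using this
  -- The separating hyperplane is not vertical, as `(y, h y)` lies in `W` and `(y, h y + 1)` in `S`.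
  have hτ0 : τ < 0 := by
    have h1 := hΦS (y, h y + 1) ⟨mem_univ _, by simp⟩
    rw [hΦ] at h1 hb
    linarith
  have hepi : ∀ w, ⟪p, w⟫_ℝ + h w * τ ≤ ⟪p, y⟫_ℝ + h y * τ := by
    intro w
    rw [← hΦ y]
    refine le_trans ?_ hb
    refine le_of_forall_pos_le_add fun ε hε => ?_
    have h1 := hΦS (w, h w + ε / (-τ)) ⟨mem_univ _, by
      have : 0 < ε / (-τ) := div_pos hε (neg_pos.2 hτ0)
      simpa using this⟩
    rw [hΦ] at h1
    have h2 : ε / (-τ) * τ = -ε := by rw [div_neg, neg_mul, div_mul_cancel₀ _ hτ0.ne]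
    nlinarith
  have hsub : ∀ v ∈ T, b ≤ Φ (y, h y) + (⟪p, J v⟫_ℝ - ⟪g, v⟫_ℝ * τ) := by
    intro v hv
    have := hΦW ((y, h y) + A v) ⟨A v, ⟨v, hv, rfl⟩, rfl⟩
    rw [map_add, show A v = (J v, -⟪g, v⟫_ℝ) by simp [A], hΦ (J v)] at this
    linarith
  -- A linear functional bounded below on a subspace vanishes; the multiple of `v` is chosen so that
  -- `hsub` would read `b ≤ b - 1`.
  have hzero : ∀ v ∈ T, ⟪p, J v⟫_ℝ - ⟪g, v⟫_ℝ * τ = 0 := by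
    intro v hv
    by_contra hne
    set q := ⟪p, J v⟫_ℝ - ⟪g, v⟫_ℝ * τ
    have := hsub (((b - Φ (y, h y) - 1) / q) • v) (T.smul_mem _ hv)
    rw [map_smul, inner_smul_right, inner_smul_right, mul_assoc, ← mul_sub,
      div_mul_cancel₀ _ hne] at this
    linarith
  refine ⟨(-τ)⁻¹ • p, fun w => ?_, fun v hv => ?_⟩
  · have h1 := hepi w
    rw [inner_smul_left, inner_sub_right]
    simp only [conj_trivial]
    have h2 : (-τ)⁻¹ * (⟪p, w⟫_ℝ - ⟪p, y⟫_ℝ) ≤ h w - h y := by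
      rw [inv_mul_le_iff₀ (neg_pos.2 hτ0)]
      linarith
    linarith
  · have h1 := hzero v hv
    rw [inner_smul_left]
    simp only [conj_trivial]
    have h2 : ⟪p, J v⟫_ℝ = ⟪g, v⟫_ℝ * τ := by linarith
    rw [h2, inv_neg, neg_mul, mul_comm, mul_assoc, mul_inv_cancel₀ hτ0.ne]
    ring

/-! ### Line search, stationarity of limits, and vanishing steps. -/

section Convergence

variable {n m : ℕ} {d : ℕ} {M : Set (EuclideanSpace ℝ (Fin n))}
  [ChartedSpace (EuclideanSpace ℝ (Fin d)) M] {P : Problem n m}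

/-- The linearized model is an upper model of `F` along the retraction, up to a quadratic error
that is uniform over the compact manifold. -/
lemma exists_F_retraction_le (hP : P.Regular) (hMc : IsCompact M)
    {Retr : (z : M) → tangent d z → M} (hRb : RetractionBounds d Retr) :
    ∃ C > 0, ∀ (z : M) (ξ : tangent d z),
      P.F (Retr z ξ) ≤ P.lin (z + (ξ : EuclideanSpace ℝ (Fin n))) z + C * ‖ξ‖ ^ 2 := by
  obtain ⟨M₁, hM₁, M₂, hM₂, hb⟩ := hRb
  obtain ⟨Lf, hLf, hf⟩ := hP.f_lip
  obtain ⟨Lc, hLc, hc⟩ := hP.c_lip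
  obtain ⟨Lh, hLh, hh⟩ := hP.h_lip
  obtain ⟨Gf, hGf⟩ := hMc.exists_bound_of_continuousOn hP.continuous_gradient.continuousOn
  obtain ⟨Gc, hGc⟩ := hMc.exists_bound_of_continuousOn
    (hP.c_smooth.continuous_fderiv one_ne_zero).continuousOn
  have hf' : ∀ x y, ‖fderiv ℝ P.f x - fderiv ℝ P.f y‖ ≤ Lf * ‖x - y‖ := by
    intro x y
    have h := hf x y
    rwa [gradient, gradient, ← map_sub, LinearIsometryEquiv.norm_map] at h
  -- The `M₁²` terms are Taylor errors; the `M₂` terms come from replacing `w - x` by `ξ` in the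
  -- derivatives. Absolute values keep the constant positive even if `M` is empty.
  refine ⟨Lf * M₁ ^ 2 + |Gf| * M₂ + Lh * (Lc * M₁ ^ 2 + |Gc| * M₂), by positivity,
    fun z ξ => ?_⟩
  obtain ⟨b1, b2⟩ := hb z ξ
  set x : EuclideanSpace ℝ (Fin n) := z.1
  set w : EuclideanSpace ℝ (Fin n) := (Retr z ξ).1
  set v : EuclideanSpace ℝ (Fin n) := ξ.1
  set r := ‖ξ‖
  have b1' : ‖w - x‖ ^ 2 ≤ M₁ ^ 2 * r ^ 2 := by
    rw [← mul_pow]; exact pow_le_pow_left₀ (norm_nonneg _) b1 2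
  have b2' : ‖(w - x) - v‖ ≤ M₂ * r ^ 2 := by rwa [sub_sub]
  have f1 := norm_sub_sub_fderiv_le hLf.le hP.differentiable_f hf' w x
  have f2 : ⟪gradient P.f x, w - x⟫_ℝ = fderiv ℝ P.f x (w - x) :=
    InnerProductSpace.toDual_symm_apply
  have f3 : ⟪gradient P.f x, w - x⟫_ℝ ≤ ⟪gradient P.f x, v⟫_ℝ + |Gf| * (M₂ * r ^ 2) := by
    have h1 : ⟪gradient P.f x, w - x⟫_ℝ =
        ⟪gradient P.f x, v⟫_ℝ + ⟪gradient P.f x, (w - x) - v⟫_ℝ := by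
      rw [← inner_add_right, add_sub_cancel]
    have h2 := real_inner_le_norm (gradient P.f x) ((w - x) - v)
    have h3 := mul_le_mul ((hGf x z.2).trans (le_abs_self Gf)) b2' (norm_nonneg _) (abs_nonneg _)
    linarith
  have f4 : P.f w ≤ P.f x + ⟪gradient P.f x, v⟫_ℝ +
      (Lf * M₁ ^ 2 + |Gf| * M₂) * r ^ 2 := by
    have h1 := (abs_le.1 f1).2
    have h2 := mul_le_mul_of_nonneg_left b1' hLf.le
    linarith
  have c1 := norm_sub_sub_fderiv_le hLc.le hP.differentiable_c hc w x
  have c2 : ‖P.c w - (P.c x + fderiv ℝ P.c x v)‖ ≤ (Lc * M₁ ^ 2 + |Gc| * M₂) * r ^ 2 := by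
    have h1 : P.c w - (P.c x + fderiv ℝ P.c x v) =
        (P.c w - P.c x - fderiv ℝ P.c x (w - x)) + fderiv ℝ P.c x ((w - x) - v) := by
      rw [map_sub (fderiv ℝ P.c x) (w - x)]; abel
    rw [h1]
    refine (norm_add_le _ _).trans ?_
    have h2 := (fderiv ℝ P.c x).le_opNorm ((w - x) - v)
    have h3 := mul_le_mul ((hGc x z.2).trans (le_abs_self Gc)) b2' (norm_nonneg _) (abs_nonneg _)
    have h4 := mul_le_mul_of_nonneg_left b1' hLc.le
    linarith
  have c3 := (abs_le.1 (hh (P.c w) (P.c x + fderiv ℝ P.c x v))).2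
  have c4 := mul_le_mul_of_nonneg_left c2 hLh.le
  unfold Problem.F Problem.lin
  rw [add_sub_cancel_left]
  linarith

/-- The line search test holds at a power of `1/2` that does not depend on the iterate. -/
lemma exists_lineSearchTest (hP : P.Regular) (hMc : IsCompact M)
    {Retr : (z : M) → tangent d z → M} (hRb : RetractionBounds d Retr)
    {IT : InexactType} (hIT : IT.Valid) {t : ℝ} (ht : 0 < t) :
    ∃ s : ℕ, ∀ (z : M) (y : EuclideanSpace ℝ (Fin n)) (hy : y - z ∈ tangent d z),
      IsInexactSolution d P IT t z y →
        LineSearchTest d P Retr IT t z ⟨y - z, hy⟩ ((1 / 2) ^ s) := by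
  obtain ⟨C, hC, hle⟩ := exists_F_retraction_le hP hMc hRb
  have hc := IT.c₀_pos
  -- With `aC < c₀/(4t)`, the retraction error uses at most half of the guaranteed model decrease,
  -- which serves both tests.
  obtain ⟨s, hs⟩ := exists_pow_lt_of_lt_one (show 0 < IT.c₀ / (4 * t) / C by positivity)
    (show (1 / 2 : ℝ) < 1 by norm_num)
  refine ⟨s, fun z y hy hin => ?_⟩
  have ha0 : (0 : ℝ) < (1 / 2) ^ s := by positivity
  have ha1 : ((1 : ℝ) / 2) ^ s ≤ 1 := pow_le_one₀ (by norm_num) (by norm_num)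
  set a : ℝ := (1 / 2) ^ s
  rw [lt_div_iff₀ hC] at hs
  have h1 := hle z (a • ⟨y - z, hy⟩)
  have h2 := hP.lin_combo_le ha0.le ha1 z y z
  have h3 := hin.decrease hP hIT ht
  have e1 : (1 - a) • (z : EuclideanSpace ℝ (Fin n)) + a • y = z + a • (y - z) := by module
  have e2 : ‖a • (⟨y - z, hy⟩ : tangent d z)‖ ^ 2 =
      a ^ 2 * ‖y - (z : EuclideanSpace ℝ (Fin n))‖ ^ 2 := by
    rw [norm_smul, mul_pow, Real.norm_of_nonneg ha0.le]; rfl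
  rw [e1, Problem.lin_self] at h2
  rw [e2] at h1
  simp only [Submodule.coe_smul] at h1
  have h4 : C * (a ^ 2 * ‖y - (z : EuclideanSpace ℝ (Fin n))‖ ^ 2) ≤
      IT.c₀ * a / (4 * t) * ‖y - (z : EuclideanSpace ℝ (Fin n))‖ ^ 2 := by
    have h5 := mul_le_mul_of_nonneg_right hs.le
      (show 0 ≤ a * ‖y - (z : EuclideanSpace ℝ (Fin n))‖ ^ 2 by positivity)
    calc _ = a * C * (a * ‖y - (z : EuclideanSpace ℝ (Fin n))‖ ^ 2) := by ring
      _ ≤ _ := h5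
      _ = _ := by ring
  have h6 : 2 * (IT.c₀ * a / (4 * t) * ‖y - (z : EuclideanSpace ℝ (Fin n))‖ ^ 2) ≤
      a * (P.F z - P.lin y z) := by
    calc _ = a * (IT.c₀ / (2 * t) * ‖y - (z : EuclideanSpace ℝ (Fin n))‖ ^ 2) := by
          field_simp; ring
      _ ≤ _ := mul_le_mul_of_nonneg_left h3 ha0.le
  refine ⟨?_, ?_⟩
  · simp only [Submodule.coe_norm]
    linarith
  · simp only
    linarith

/-- The largest passing power of `1/2` has the least passing exponent. -/
lemma exists_isLineSearchStep_of_test {Retr : (z : M) → tangent d z → M} {IT : InexactType}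
    {t : ℝ} {z : M} {ξ : tangent d z} {s : ℕ}
    (h : LineSearchTest d P Retr IT t z ξ ((1 / 2) ^ s)) :
    ∃ α, IsLineSearchStep d P Retr IT t z ξ α := by
  classical
  have hex : ∃ s : ℕ, LineSearchTest d P Retr IT t z ξ ((1 / 2) ^ s) := ⟨s, h⟩
  refine ⟨(1 / 2) ^ Nat.find hex, ⟨⟨_, rfl⟩, Nat.find_spec hex⟩, ?_⟩
  rintro _ ⟨⟨k, rfl⟩, hk⟩
  exact pow_le_pow_of_le_one (by norm_num) (by norm_num) (Nat.find_min' hex hk)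

/-- If the proximal model at `z` is minimized over `z + T_z M` by `z` itself, then `z` is
stationary. -/
lemma isStationary_of_forall_le_prox (hP : P.Regular) (t : ℝ) {z : M}
    (h : ∀ v ∈ tangent d z, P.F z ≤ P.prox t (z + v) z) : IsStationary d P z := by
  -- The proximal term is second order: test `a • v`, divide by `a`, let `a → 0`.
  have hlin : ∀ v ∈ tangent d z, P.F z ≤ P.lin (z + v) z := by
    intro v hv
    have key : ∀ a : ℝ, 0 < a → a ≤ 1 →
        P.F z - a * (1 / (2 * t) * ‖v‖ ^ 2) ≤ P.lin (z + v) z := by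
      intro a ha ha'
      have h1 := h (a • v) (Submodule.smul_mem _ _ hv)
      have h2 := hP.lin_combo_le ha.le ha' z (z + v) z
      have e : (1 - a) • (z : EuclideanSpace ℝ (Fin n)) + a • (z + v) = z + a • v := by module
      rw [e, Problem.lin_self] at h2
      rw [Problem.prox, add_sub_cancel_left, norm_smul, mul_pow, Real.norm_of_nonneg ha.le] at h1
      refine le_of_mul_le_mul_left ?_ ha
      linarith
    have hlim : Tendsto (fun a : ℝ => P.F z - a * (1 / (2 * t) * ‖v‖ ^ 2)) (𝓝[>] 0)
        (𝓝 (P.F z - 0 * (1 / (2 * t) * ‖v‖ ^ 2))) :=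
      (Continuous.tendsto (by fun_prop) 0).mono_left nhdsWithin_le_nhds
    rw [zero_mul, sub_zero] at hlim
    refine le_of_tendsto hlim ?_
    filter_upwards [Ioo_mem_nhdsGT (show (0 : ℝ) < 1 by norm_num)] with a ha
    exact key a ha.1 ha.2.le
  obtain ⟨u, hu, huT⟩ := exists_subgradient_of_forall_le hP.h_convex hP.continuous_h
    (tangent d z) (fderiv ℝ P.c z) (gradient P.f z) (P.c z) (fun v hv => by
      have h1 := hlin v hv
      rw [Problem.lin, Problem.F, add_sub_cancel_left] at h1
      linarith)
  refine ⟨_, ⟨u, hu, rfl⟩, ?_⟩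
  rw [Submodule.starProjection_apply, Submodule.coe_eq_zero,
    Submodule.orthogonalProjectionOnto_eq_zero_iff, Submodule.mem_orthogonal']
  intro v hv
  rw [inner_add_left, ContinuousLinearMap.adjoint_inner_left]
  linarith [huT v hv]

/-- The tolerance of the subproblem vanishes as the inexact solutions approach the base points. -/
lemma tendsto_tolerance (hP : P.Regular) (IT : InexactType) (t : ℝ) {ι : Type*} {l : Filter ι}
    {z y : ι → EuclideanSpace ℝ (Fin n)} {x : EuclideanSpace ℝ (Fin n)}
    (hz : Tendsto z l (𝓝 x)) (hy : Tendsto y l (𝓝 x)) :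
    Tendsto (fun k => IT.tolerance P t (z k) (y k)) l (𝓝 0) := by
  cases IT with
  | lacc ρ =>
    have h1 := (hP.continuous_F.tendsto x).comp hz
    have h2 := ((hP.continuous_prox t).tendsto (x, x)).comp (hy.prodMk_nhds hz)
    have h3 := (h1.sub h2).const_mul ρ
    simpa [InexactType.tolerance] using h3
  | hacc ρ =>
    have h3 := (((hy.sub hz).norm).pow 2).const_mul (ρ / (2 * t))
    simpa [InexactType.tolerance] using h3

/-- A limit of points whose inexact solutions approach them is stationary. -/
lemma isStationary_of_tendsto [IsManifold (𝓡 d) 1 M]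
    (hM : ContMDiff (𝓡 d) 𝓘(ℝ, EuclideanSpace ℝ (Fin n)) 1
      (Subtype.val : M → EuclideanSpace ℝ (Fin n)))
    (hP : P.Regular) {IT : InexactType} {t : ℝ} (ht : 0 < t) {ι : Type*} {l : Filter ι} [l.NeBot]
    {z : ι → M} {x : M} {y : ι → EuclideanSpace ℝ (Fin n)} (hz : Tendsto z l (𝓝 x))
    (hin : ∀ k, IsInexactSolution d P IT t (z k) (y k))
    (hy : Tendsto (fun k => y k - z k) l (𝓝 0)) : IsStationary d P x := by
  have hz' : Tendsto (fun k => (z k : EuclideanSpace ℝ (Fin n))) l (𝓝 x) :=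
    (continuous_subtype_val.tendsto x).comp hz
  have hy' : Tendsto y l (𝓝 x) := by simpa using hy.add hz'
  refine isStationary_of_forall_le_prox hP t fun v hv => ?_
  -- The subproblem at `z k` only admits directions tangent at `z k`, so `v` is replaced by `V (z
  -- k)`.
  obtain ⟨V, hV, hVlim⟩ := exists_tangent_vector_field hM x hv
  have h1 := ((hP.continuous_prox t).tendsto (x, x)).comp (hy'.prodMk_nhds hz')
  have h2 := tendsto_tolerance hP IT t hz' hy'
  have h3 := ((hP.continuous_prox t).tendsto (x + v, x)).comp
    ((hz'.add (hVlim.comp hz)).prodMk_nhds hz')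
  have h4 := h1.sub h2
  simp only [sub_zero, Problem.prox_self] at h4
  refine le_of_tendsto_of_tendsto' h4 h3 fun k => ?_
  obtain ⟨s, hs⟩ := exists_isExactSolution (d := d) hP ht (z k)
  have h5 := (hin k).2 s hs
  have h6 := hs.2 (z k + V (z k)) (by simpa using hV (z k))
  simp only [Function.comp_apply]
  linarith

/-- Along the iterates, the inexact solutions approach the base points. -/
lemma IsIterates.exists_tendsto (hP : P.Regular) (hMc : IsCompact M)
    {Retr : (z : M) → tangent d z → M} (hRb : RetractionBounds d Retr)
    {IT : InexactType} (hIT : IT.Valid) {t : ℝ} (ht : 0 < t) {z : ℕ → M}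
    (hz : IsIterates d P Retr IT (fun _ => t) z) :
    ∃ y : ℕ → EuclideanSpace ℝ (Fin n), (∀ k, IsInexactSolution d P IT t (z k) (y k)) ∧
      Tendsto (fun k => y k - z k) atTop (𝓝 0) := by
  choose y hyT α hin hα hstep using hz
  refine ⟨y, hin, ?_⟩
  obtain ⟨s, hs⟩ := exists_lineSearchTest hP hMc hRb hIT ht
  set κ := IT.c₀ * (1 / 2) ^ s / (4 * t) with hκ
  have hc := IT.c₀_pos
  have hκ0 : 0 < κ := by positivity
  have hdec : ∀ k, κ * ‖y k - z k‖ ^ 2 ≤ P.F (z k) - P.F (z (k + 1)) := by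
    intro k
    -- The accepted `α k` is the greatest passing power, hence at least the uniform one `(1 / 2) ^
    -- s`.
    have h1 := (hα k).2 ⟨⟨s, rfl⟩, hs (z k) (y k) (hyT k) (hin k)⟩
    have h2 := (hα k).1.2.1
    rw [← hstep k, Submodule.coe_norm] at h2
    refine le_trans ?_ h2
    rw [hκ]
    gcongr
  have hanti : Antitone fun k => P.F (z k) := antitone_nat_of_succ_le fun k => by
    have h1 := hdec k
    have h2 : 0 ≤ κ * ‖y k - z k‖ ^ 2 := by positivity
    linarith
  obtain ⟨B, hB⟩ := hMc.exists_bound_of_continuousOn hP.continuous_F.continuousOn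
  have hbdd : BddBelow (range fun k => P.F (z k)) := by
    refine ⟨-B, ?_⟩
    rintro _ ⟨k, rfl⟩
    exact (abs_le.1 (hB (z k) (z k).2)).1
  have hlim := tendsto_atTop_ciInf hanti hbdd
  have hdiff := hlim.sub (hlim.comp (tendsto_add_atTop_nat 1))
  rw [sub_self] at hdiff
  have hsq : Tendsto (fun k => ‖y k - z k‖ ^ 2) atTop (𝓝 0) := by
    have h1 := squeeze_zero (fun k => by positivity) hdec hdiff
    have h2 := h1.const_mul κ⁻¹
    simpa [← mul_assoc, hκ0.ne'] using h2
  rw [tendsto_zero_iff_norm_tendsto_zero]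
  have h3 := hsq.sqrt
  simpa using h3

end Convergence

end IManPL

theorem mainTheorem1 {n m d : ℕ} (P : IManPL.Problem n m) (hP : P.Regular)
    (M : Set (EuclideanSpace ℝ (Fin n))) [ChartedSpace (EuclideanSpace ℝ (Fin d)) M]
    [IsManifold (𝓡 d) ∞ M]
    (hM : Manifold.IsSmoothEmbedding (𝓡 d) 𝓘(ℝ, EuclideanSpace ℝ (Fin n)) ∞
      (Subtype.val : M → EuclideanSpace ℝ (Fin n)))
    (hMc : IsCompact M)
    (Retr : (z : M) → IManPL.tangent d z → M) (hR : IManPL.IsRetraction d Retr)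
    (hRb : IManPL.RetractionBounds d Retr)
    (IT : IManPL.InexactType) (hIT : IT.Valid) (t : ℝ) (ht : 0 < t) :
    -- the line search of the algorithm always terminates
    (∀ (z : M) (ztil : EuclideanSpace ℝ (Fin n)) (hz : ztil - z ∈ IManPL.tangent d z),
      IManPL.IsInexactSolution d P IT t z ztil →
        ∃ α, IManPL.IsLineSearchStep d P Retr IT t z ⟨ztil - z, hz⟩ α) ∧
    -- the iterates accumulate, and only at stationary points
    (∀ z : ℕ → M, IManPL.IsIterates d P Retr IT (fun _ => t) z →
      (∃ zstar : EuclideanSpace ℝ (Fin n),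
        MapClusterPt zstar Filter.atTop (fun k => (z k : EuclideanSpace ℝ (Fin n)))) ∧
      ∀ zstar : EuclideanSpace ℝ (Fin n),
        MapClusterPt zstar Filter.atTop (fun k => (z k : EuclideanSpace ℝ (Fin n))) →
          ∃ hz : zstar ∈ M, IManPL.IsStationary d P (⟨zstar, hz⟩ : M)) := by
  refine ⟨fun z y hy hin => ?_, fun z hz => ⟨?_, fun zstar hcl => ?_⟩⟩
  · obtain ⟨s, hs⟩ := IManPL.exists_lineSearchTest hP hMc hRb hIT ht
    exact IManPL.exists_isLineSearchStep_of_test (hs z y hy hin)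
  · obtain ⟨x, -, hx⟩ := hMc.exists_mapClusterPt (f := Filter.atTop)
      (u := fun k => (z k : EuclideanSpace ℝ (Fin n))) (by simp)
    exact ⟨x, hx⟩
  -- An ultrafilter finer than `atTop` plays the role of a convergent subsequence.
  · obtain ⟨U, hU, hlim⟩ := mapClusterPt_iff_ultrafilter.1 hcl
    have hmem : zstar ∈ M :=
      hMc.isClosed.mem_of_tendsto hlim (Filter.Eventually.of_forall fun k => (z k).2)
    obtain ⟨y, hin, hy⟩ := hz.exists_tendsto hP hMc hRb hIT ht
    have hM1 : IsManifold (𝓡 d) 1 M := IsManifold.of_le (n := ∞) (by norm_cast)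
    refine ⟨hmem, IManPL.isStationary_of_tendsto (hM.contMDiff.of_le (by norm_cast))
      hP ht (tendsto_subtype_rng.2 hlim) hin (hy.mono_left hU)⟩
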